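/- Let $q$ be a prime power, $n\ge 1$, let $k$ be a finite field of cardinality $q^n$, $k'\subseteq k$ its subfield of cardinality $q$, and let $\alpha_0,\dots,\alpha_{n-1}$ be a basis of $k$ over $k'$. *Weil descent.* For $f\in k[X]$ let $[f]_0,\dots,[f]_{n-1}\in k'[X_0,\dots,X_{n-1}]$ be the unique polynomials with $\deg_{X_i}([f]_j)\le q-1$ for all $i,j$ and $$f\Big(\sum_{j=0}^{n-1}\alpha_jX_j\Big)\equiv\sum_{j=0}^{n-1}[f]_j\,\alpha_j \pmod{(X_j^q-X_j \mid j=0,\dots,n-1)}$$ in $k[X_0,\dots,X_{n-1}]$. For $\mathcal F=\{f\}$ put $\mathcal F'=\{[f]_j : j=0,\dots,n-1\}$ and $\mathcal F'_f=\mathcal F'\cup\{X_j^q-X_j : j=0,\dots,n-1\}$ (the subscript $f$ in $\mathcal F'_f$ stands for "field equations"). *Last fall degree.* For a finite set $\mathcal E$ of polynomials in $S=k'[X_0,\dots,X_{n-1}]$ and $i\in\mathbb Z_{\ge0}$, let $V_{\mathcal E,i}$ be the smallest $k'$-vector subspace of $S$ that contains every element of $\mathcal E$ of degree at most $i$ and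 such that $gh\in V_{\mathcal E,i}$ whenever $g\in V_{\mathcal E,i}$, $h\in S$ and $\deg(gh)\le i$; let $V_{\mathcal E,\infty}=\bigcup_{i\ge0}V_{\mathcal E,i}$. The last fall degree $d_{\mathcal E}$ is the minimal $d\in\mathbb Z_{\ge0}\cup\{\infty\}$ such that $g\in V_{\mathcal E,\max\{d,\deg g\}}$ for every $g$ in the ideal of $S$ generated by $\mathcal E$. **Corollary.** Let $$f=\sum_{i,j}\beta_{i,j}X^{q^{\theta_{ij}}+q^{\varphi_{ij}}}+\sum_\ell a_\ell X^{q^{\zeta_\ell}}+\mu\in k[X]$$ be a finite sum with $\beta_{i,j},a_\ell,\mu\in k$ and non-negative integers $\theta_{ij},\varphi_{ij},\zeta_\ell$, and let $t\ge0$ be an integer with $\deg(f)\le q^t$. Then, for $\mathcal F=\{f\}$, $$d_{\mathcal F'_f}\le (q-1)(t+1)+1 .$$ -/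

import Mathlib

open MvPolynomial

namespace HFE

section LastFall

variable {σ k : Type*} [Field k]

/-- The closure conditions in degree `i`: `W` contains all elements of `E` of degree at most `i`,
and contains `g * h` whenever `g ∈ W` and `deg (g * h) ≤ i`. -/
def IsClosedInDegree (E : Set (MvPolynomial σ k)) (i : ℕ)
    (W : Submodule k (MvPolynomial σ k)) : Prop :=
  (∀ f ∈ E, f.totalDegree ≤ i → f ∈ W) ∧
    ∀ g ∈ W, ∀ h : MvPolynomial σ k, (g * h).totalDegree ≤ i → g * h ∈ W

/-- `V_{E,i}`, the smallest `k`-subspace satisfying the closure conditions in degree `i`. -/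
noncomputable def constructible (E : Set (MvPolynomial σ k)) (i : ℕ) :
    Submodule k (MvPolynomial σ k) :=
  sInf {W | IsClosedInDegree E i W}

/-- The subspaces satisfying the closure conditions do have a smallest element. -/
theorem isLeast_constructible (E : Set (MvPolynomial σ k)) (i : ℕ) :
    IsLeast {W | IsClosedInDegree E i W} (constructible E i) := by
  refine ⟨⟨fun f hf hd => ?_, fun g hg h hd => ?_⟩, fun W hW => sInf_le hW⟩
  · exact (Submodule.mem_sInf).2 fun W hW => hW.1 f hf hd
  · exact (Submodule.mem_sInf).2 fun W hW => hW.2 g ((Submodule.mem_sInf).1 hg W hW) h hd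

/-- `V_{E,d}` for `d ∈ ℕ ∪ {∞}`, where `V_{E,∞}` is the union of all `V_{E,i}`. -/
def constructibleSet (E : Set (MvPolynomial σ k)) : ℕ∞ → Set (MvPolynomial σ k)
  | ⊤ => ⋃ i : ℕ, (constructible E i : Set (MvPolynomial σ k))
  | (i : ℕ) => (constructible E i : Set (MvPolynomial σ k))

/-- The last fall degree of `E`: the minimal `d ∈ ℕ ∪ {∞}` such that every `f` in the ideal
generated by `E` lies in `V_{E, max (d, deg f)}`. -/
noncomputable def lastFallDegree (E : Set (MvPolynomial σ k)) : ℕ∞ :=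
  sInf {d : ℕ∞ | ∀ f ∈ Ideal.span E, f ∈ constructibleSet E (max d (f.totalDegree : ℕ∞))}

end LastFall

section WeilDescent

variable {k' k : Type*} [Field k'] [Field k] [Algebra k' k] {n : ℕ}

/-- The family `c` consists of the Weil descent components `[f]_0, …, [f]_{n-1}` of `f` with
respect to the basis `α` of `k` over `k'`, where `q = |k'|`: every `c j` has degree at most `q - 1`
in every variable, and `f (∑ j, α j * X j) ≡ ∑ j, c j * α j` in `k[X_0, …, X_{n-1}]`,
modulo the ideal generated by the polynomials `X_j ^ q - X_j`. -/
def IsWeilDescent (α : Module.Basis (Fin n) k' k) (f : Polynomial k)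
    (c : Fin n → MvPolynomial (Fin n) k') : Prop :=
  (∀ i j, (c j).degreeOf i ≤ Nat.card k' - 1) ∧
    Polynomial.aeval (∑ j, C (α j) * X j : MvPolynomial (Fin n) k) f
        - ∑ j, map (algebraMap k' k) (c j) * C (α j) ∈
      Ideal.span (Set.range fun j : Fin n => (X j ^ Nat.card k' - X j : MvPolynomial (Fin n) k))

theorem exists_reduced_exponent {q : ℕ} (hq : 2 ≤ q) (e : ℕ) :
    ∃ r ≤ q - 1, ∀ {A : Type _} [CommRing A] (x : A), x ^ q = x → x ^ e = x ^ r := by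
  induction e with
  | zero => exact ⟨0, by omega, fun x _ => rfl⟩
  | succ e ih =>
    obtain ⟨r, hr, h⟩ := ih
    by_cases hr' : r + 1 ≤ q - 1
    · exact ⟨r + 1, hr', fun x hx => by rw [pow_succ, h x hx, pow_succ]⟩
    · refine ⟨1, by omega, fun x hx => ?_⟩
      have : r + 1 = q := by omega
      rw [pow_succ, h x hx, ← pow_succ, this, hx, pow_one]

theorem exists_reduced_components [Finite k'] (α : Module.Basis (Fin n) k' k)
    (p : MvPolynomial (Fin n) k) :
    ∃ c : Fin n → MvPolynomial (Fin n) k',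
      (∀ i j, (c j).degreeOf i ≤ Nat.card k' - 1) ∧
      p - ∑ j, map (algebraMap k' k) (c j) * C (α j) ∈ Ideal.span
        (Set.range fun j : Fin n => (X j ^ Nat.card k' - X j : MvPolynomial (Fin n) k)) := by
  have hq : 2 ≤ Nat.card k' := Finite.one_lt_card
  induction p using MvPolynomial.induction_on' with
  | add p₁ p₂ h₁ h₂ =>
    obtain ⟨c₁, hc₁, hm₁⟩ := h₁
    obtain ⟨c₂, hc₂, hm₂⟩ := h₂
    refine ⟨fun j => c₁ j + c₂ j, fun i j => ?_, ?_⟩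
    · exact (degreeOf_add_le i _ _).trans (max_le (hc₁ i j) (hc₂ i j))
    · convert Ideal.add_mem _ hm₁ hm₂ using 1
      simp only [map_add, add_mul, Finset.sum_add_distrib]
      ring
  | monomial s a =>
    choose r hr hpow using fun e : ℕ => exists_reduced_exponent hq e
    let s' : Fin n →₀ ℕ := Finsupp.equivFunOnFinite.symm fun i => r (s i)
    refine ⟨fun j => monomial s' (α.repr a j), fun i j => ?_, ?_⟩
    · by_cases h0 : α.repr a j = 0
      · simp [h0]
      · rw [degreeOf_monomial_eq _ _ h0]
        exact hr (s i)
    · have hsum : ∑ j, map (algebraMap k' k) (monomial s' (α.repr a j)) * C (α j)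
          = monomial s' a := by
        conv_rhs => rw [← α.sum_repr a]
        rw [map_sum]
        refine Finset.sum_congr rfl fun j _ => ?_
        rw [map_monomial, mul_comm, C_mul_monomial, Algebra.smul_def, mul_comm]
      rw [hsum, ← Ideal.Quotient.eq, monomial_eq, monomial_eq, map_mul, map_mul,
        Finsupp.prod_fintype _ _ (by simp), Finsupp.prod_fintype _ _ (by simp), map_prod, map_prod]
      congr 1
      refine Finset.prod_congr rfl fun i _ => ?_
      rw [map_pow, map_pow]
      refine hpow (s i) _ ?_
      rw [← map_pow, Ideal.Quotient.eq]
      exact Ideal.subset_span ⟨i, rfl⟩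

theorem existsUnique_isWeilDescent [Finite k'] (α : Module.Basis (Fin n) k' k)
    (f : Polynomial k) : ∃! c, IsWeilDescent α f c := by
  obtain ⟨c, hc⟩ := exists_reduced_components α
    (Polynomial.aeval (∑ j, C (α j) * X j : MvPolynomial (Fin n) k) f)
  refine ⟨c, hc, fun d hd => funext fun j => ?_⟩
  have hmem := Ideal.sub_mem _ hc.2 hd.2
  have := Fintype.ofFinite k'
  rw [← sub_eq_zero]
  refine MvPolynomial.eq_zero_of_eval_zero_at_prod_finset (d j - c j) (fun _ => Finset.univ)
    (fun i => ?_) (fun v _ => ?_)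
  · have h2 : (d j - c j).degreeOf i ≤ Nat.card k' - 1 :=
      (degreeOf_sub_le i _ _).trans (max_le (hd.1 i j) (hc.1 i j))
    have hpos : 0 < Nat.card k' := Nat.card_pos
    rw [Finset.card_univ, ← Nat.card_eq_fintype_card]
    omega
  · have hker : Ideal.span (Set.range fun j : Fin n =>
          (X j ^ Nat.card k' - X j : MvPolynomial (Fin n) k)) ≤
        RingHom.ker (eval fun i => algebraMap k' k (v i)) := by
      rw [Ideal.span_le]
      rintro _ ⟨i, rfl⟩
      have hv : v i ^ Nat.card k' = v i := by
        rw [Nat.card_eq_fintype_card]; exact FiniteField.pow_card _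
      simp only [SetLike.mem_coe, RingHom.mem_ker, map_sub, map_pow, eval_X]
      rw [← map_pow, hv, sub_self]
    have h0 := RingHom.mem_ker.1 (hker hmem)
    have hev : ∀ p : MvPolynomial (Fin n) k',
        eval (fun i => algebraMap k' k (v i)) (map (algebraMap k' k) p)
          = algebraMap k' k (eval v p) := fun p => by
      rw [eval_map, ← coe_eval₂Hom]
      exact (congrFun (congrArg DFunLike.coe (comp_eval₂Hom (RingHom.id k') v (algebraMap k' k))) p).symm
    have h1 : ∑ j, eval v (d j - c j) • α j = 0 := by
      simp only [map_sub, map_sum, map_mul, hev, eval_C] at h0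
      simp only [map_sub, Algebra.smul_def, sub_mul, Finset.sum_sub_distrib]
      linear_combination h0
    exact (Fintype.linearIndependent_iff.1 α.linearIndependent) _ h1 j

/-- The Weil descent components `[f]_0, …, [f]_{n-1} ∈ k'[X_0, …, X_{n-1}]` of `f`. -/
noncomputable def weilDescent [Finite k'] (α : Module.Basis (Fin n) k' k) (f : Polynomial k) :
    Fin n → MvPolynomial (Fin n) k' :=
  (existsUnique_isWeilDescent α f).choose

/-- The Weil descent system `𝓕' = {[f]_j : f ∈ 𝓕, j = 0, …, n - 1}`. -/
def weilDescentSystem [Finite k'] (α : Module.Basis (Fin n) k' k) (F : Set (Polynomial k)) :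
    Set (MvPolynomial (Fin n) k') :=
  {g | ∃ f ∈ F, ∃ j, g = weilDescent α f j}

/-- The Weil descent system with the field equations `X_j ^ q - X_j` added, `q = |k'|`. -/
def weilDescentSystemWithFieldEqs [Finite k'] (α : Module.Basis (Fin n) k' k)
    (F : Set (Polynomial k)) : Set (MvPolynomial (Fin n) k') :=
  weilDescentSystem α F ∪ Set.range fun j : Fin n => X j ^ Nat.card k' - X j

end WeilDescent

end HFE

/-!
# The last fall degree of the Weil descent of a quadratic HFE polynomial

Write `q = |k'|`, `d = (q - 1) (t + 1) + 1` and, over `k`, `Y_i = ∑ j, α_j ^ (q ^ i) X_j` for the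
conjugates of the generic element `Y_0` of `k` (`conjForm`). The `Y_i` with `i < n` are a linear
change of coordinates of `k[X_0, …, X_{n-1}]`. In these coordinates the field equations say
`Y_i ^ q = Y_{i+1}` and `Y_n = Y_0`, so `Y_i ↔ T ^ (q ^ i)` identifies the quotient by the field
equations with `k[T] / (T ^ (q ^ n) - T)`. A power `T ^ m` is represented by the product of the `Y_i`
with the base `q` digits of `m` as exponents (`digitLift`). This representative has degree at most
`(q - 1) t` if `m < q ^ t`, and degree at most `2` if `m = q ^ θ + q ^ φ`.

The spaces `V_{E,N}` descend from `k` to `k'` (`mem_constructible_of_map_mem`), so the claim may be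
checked over `k`. The field equations cause no degree falls (`mem_constructible_fieldEqs`). Therefore
the Weil descent components of `f` have degree at most `2`, and the representative of `f` lies in
`V_{E,N}` for all `N ≥ d` (`digitLift_mem_constructible`).

The main step is `conjForm_mul_remLift_sub_mem`: in `V_{E,N}`, `N ≥ d`, multiplication by `Y_i` acts
on the representatives of remainders modulo `f` as multiplication by `T ^ (q ^ i)`. For `i = 0`, the
digits of `m` and `m + 1` differ by carries, and one multiple of `f` is subtracted. For the passage
from `i` to `i + 1`, `Y_{i+1}` is replaced by `Y_i ^ q`, whose factors are absorbed one by one. Since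
`deg f ≤ q ^ t`, remainders have representatives of degree at most `(q - 1) t`, and all polynomials
that occur have degree at most `q + (q - 1) t = d`.

Consequently every `g` of degree at most `N` is congruent modulo `V_{E,N}` to the representative of
the remainder modulo `f` of its univariate counterpart (`sub_remLift_aeval_mem`). If `g` is in the
ideal, this counterpart is in `(f, T ^ (q ^ n) - T)` (`aeval_tracePoly_mem_span`), and its remainder
is that of some `b T ^ (q ^ n) - b T`. Its representative vanishes modulo `V_{E,N}` because
`Y_n = Y_0` (`mem_constructible_of_aeval_mem`). For `f = 0` only the field equations remain.
-/

namespace HFE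

/-! ### The spaces `V_{E,N}` -/

section Constructible

variable {σ K : Type*} [Field K] {E : Set (MvPolynomial σ K)} {N : ℕ}

theorem mem_constructible_of_mem {g : MvPolynomial σ K} (hg : g ∈ E) (hd : g.totalDegree ≤ N) :
    g ∈ constructible E N :=
  (isLeast_constructible E N).1.1 g hg hd

theorem mul_mem_constructible {g : MvPolynomial σ K} (hg : g ∈ constructible E N)
    (h : MvPolynomial σ K) (hd : (g * h).totalDegree ≤ N) : g * h ∈ constructible E N :=
  (isLeast_constructible E N).1.2 g hg h hd

theorem mul_mem_constructible' {g h : MvPolynomial σ K} (hg : g ∈ constructible E N)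
    {a b : ℕ} (ha : g.totalDegree ≤ a) (hb : h.totalDegree ≤ b) (hab : a + b ≤ N) :
    h * g ∈ constructible E N := by
  rw [mul_comm]
  exact mul_mem_constructible hg h ((totalDegree_mul g h).trans (by omega))

theorem constructible_le_span (E : Set (MvPolynomial σ K)) (N : ℕ) :
    constructible E N ≤ (Ideal.span E).restrictScalars K :=
  (isLeast_constructible E N).2
    ⟨fun _ hg _ => Ideal.subset_span hg, fun _ hg h _ => Ideal.mul_mem_right h _ hg⟩

theorem constructible_mono {E' : Set (MvPolynomial σ K)} (h : E ⊆ E') :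
    constructible E N ≤ constructible E' N :=
  (isLeast_constructible E N).2
    ⟨fun _ hg hd => mem_constructible_of_mem (h hg) hd,
      fun _ hg h hd => mul_mem_constructible hg h hd⟩

/-- It suffices to check the defining property of the last fall degree for the elements of the
ideal, in every degree `N ≥ d` that bounds the degree of the element. -/
theorem lastFallDegree_le {d : ℕ}
    (h : ∀ N, d ≤ N → ∀ g ∈ Ideal.span E, g.totalDegree ≤ N → g ∈ constructible E N) :
    lastFallDegree E ≤ (d : ℕ∞) := by
  refine sInf_le fun g hg => ?_
  have hcast : max (d : ℕ∞) (g.totalDegree : ℕ∞) = ((max d g.totalDegree : ℕ) : ℕ∞) :=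
    (Nat.mono_cast.map_max).symm
  rw [hcast]
  exact h _ (le_max_left _ _) g hg (le_max_right _ _)

end Constructible

/-! ### Reduction modulo the field equations -/

section Reduction

variable {σ K : Type*} [Field K]

/-- The field equations `X_j ^ q - X_j`. -/
def fieldEqs (σ K : Type*) [Field K] (q : ℕ) : Set (MvPolynomial σ K) :=
  Set.range fun j : σ => X j ^ q - X j

theorem totalDegree_X_pow_sub_X_le {q : ℕ} (hq : 1 ≤ q) (j : σ) :
    (X j ^ q - X j : MvPolynomial σ K).totalDegree ≤ q := by
  refine (totalDegree_sub _ _).trans (max_le ?_ ?_)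
  · rw [totalDegree_X_pow]
  · rw [totalDegree_X]; exact hq

theorem exists_reduced_monomial {q : ℕ} (hq : 2 ≤ q) {N : ℕ} (c : K) :
    ∀ s : σ →₀ ℕ, s.degree ≤ N → ∃ p' : MvPolynomial σ K,
      (∀ i, p'.degreeOf i ≤ q - 1) ∧ p'.totalDegree ≤ N ∧
        monomial s c - p' ∈ constructible (fieldEqs σ K q) N := by
  classical
  intro s
  induction hd : s.degree using Nat.strong_induction_on generalizing s with
  | _ d ih =>
    intro hN
    subst hd
    by_cases hs : ∀ i, s i ≤ q - 1
    · refine ⟨monomial s c, fun i => ?_, (totalDegree_monomial_le s c).trans ?_, by simp⟩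
      · by_cases hc : c = 0
        · simp [hc]
        · rw [degreeOf_monomial_eq _ _ hc]; exact hs i
      · exact hN
    · push Not at hs
      obtain ⟨j, hj⟩ := hs
      -- `s = q e_j + u`, and `X^s` is congruent to `X_j X^u`, of smaller degree.
      obtain ⟨u, rfl⟩ : ∃ u, s = Finsupp.single j q + u := by
        refine ⟨s - Finsupp.single j q, (add_tsub_cancel_of_le ?_).symm⟩
        rw [Finsupp.single_le_iff]
        omega
      have hdeg : (Finsupp.single j q + u).degree = q + u.degree := by
        rw [map_add, Finsupp.degree_single]
      have hdeg1 : (Finsupp.single j 1 + u).degree = 1 + u.degree := by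
        rw [map_add, Finsupp.degree_single]
      rw [hdeg] at hN ih
      obtain ⟨p', h1, h2, h3⟩ := ih _ (by rw [hdeg1]; omega) (Finsupp.single j 1 + u) rfl
        (by rw [hdeg1]; omega)
      refine ⟨p', h1, h2, ?_⟩
      have hmem : monomial u c * (X j ^ q - X j) ∈ constructible (fieldEqs σ K q) N :=
        mul_mem_constructible' (mem_constructible_of_mem ⟨j, rfl⟩
          ((totalDegree_X_pow_sub_X_le (by omega) j).trans (by omega)))
          (totalDegree_X_pow_sub_X_le (by omega) j) (totalDegree_monomial_le u c) hN
      have heq : monomial (Finsupp.single j q + u) c - p' =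
          monomial u c * (X j ^ q - X j) + (monomial (Finsupp.single j 1 + u) c - p') := by
        rw [monomial_single_add, monomial_single_add]
        ring
      rw [heq]
      exact add_mem hmem h3

/-- A polynomial of degree at most `N` is congruent modulo `V_{E,N}`, where `E` are the field
equations, to a polynomial of degree at most `N` with all individual degrees less than `q`. -/
theorem exists_reduced {q : ℕ} (hq : 2 ≤ q) {N : ℕ} (p : MvPolynomial σ K)
    (hp : p.totalDegree ≤ N) : ∃ p' : MvPolynomial σ K,
      (∀ i, p'.degreeOf i ≤ q - 1) ∧ p'.totalDegree ≤ N ∧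
        p - p' ∈ constructible (fieldEqs σ K q) N := by
  have h : ∀ s : σ →₀ ℕ, ∃ p' : MvPolynomial σ K,
      (∀ i, p'.degreeOf i ≤ q - 1) ∧ p'.totalDegree ≤ N ∧
        monomial s (coeff s p) - p' ∈ constructible (fieldEqs σ K q) N := by
    intro s
    by_cases hs : s ∈ p.support
    · exact exists_reduced_monomial hq _ s ((le_totalDegree hs).trans hp)
    · exact ⟨0, by simp, by simp, by simp [notMem_support_iff.1 hs]⟩
  choose r h1 h2 h3 using h
  refine ⟨∑ s ∈ p.support, r s, fun i => ?_, ?_, ?_⟩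
  · exact (degreeOf_sum_le i _ _).trans (Finset.sup_le fun s _ => h1 s i)
  · exact totalDegree_finsetSum_le fun s _ => h2 s
  · nth_rewrite 1 [p.as_sum]
    rw [← Finset.sum_sub_distrib]
    exact sum_mem fun s _ => h3 s

/-- The field equations over `k'` generate an ideal of `K[X]` whose elements vanish on `k'^n`, so
that the only element of it that is reduced in every variable is zero. -/
theorem eq_zero_of_mem_span_fieldEqs (k' : Type*) [Field k'] [Finite k'] [Algebra k' K]
    [Finite σ] {p : MvPolynomial σ K} (hp : p ∈ Ideal.span (fieldEqs σ K (Nat.card k')))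
    (hdeg : ∀ i, p.degreeOf i ≤ Nat.card k' - 1) : p = 0 := by
  classical
  have := Fintype.ofFinite k'
  have hpos : 0 < Nat.card k' := Nat.card_pos
  refine eq_zero_of_eval_zero_at_prod_finset p
    (fun _ => Finset.univ.image (algebraMap k' K)) (fun i => ?_) (fun v hv => ?_)
  · rw [Finset.card_image_of_injective _ (algebraMap k' K).injective, Finset.card_univ,
      ← Nat.card_eq_fintype_card]
    have := hdeg i
    omega
  · have hker : Ideal.span (fieldEqs σ K (Nat.card k')) ≤ RingHom.ker (eval v) := by
      rw [Ideal.span_le]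
      rintro _ ⟨i, rfl⟩
      obtain ⟨y, -, hy⟩ := Finset.mem_image.1 (hv i)
      have hy' : y ^ Nat.card k' = y := by
        rw [Nat.card_eq_fintype_card]; exact FiniteField.pow_card _
      simp only [SetLike.mem_coe, RingHom.mem_ker, map_sub, map_pow, eval_X]
      rw [← hy, ← map_pow, hy', sub_self]
    exact RingHom.mem_ker.1 (hker hp)

/-- The field equations alone have no degree falls: an element of their ideal of degree at most `N`
lies in `V_{E,N}`. -/
theorem mem_constructible_fieldEqs (k' : Type*) [Field k'] [Finite k'] [Algebra k' K]
    [Finite σ] {p : MvPolynomial σ K} (hp : p ∈ Ideal.span (fieldEqs σ K (Nat.card k')))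
    {N : ℕ} (hN : p.totalDegree ≤ N) : p ∈ constructible (fieldEqs σ K (Nat.card k')) N := by
  have hq : 2 ≤ Nat.card k' := Finite.one_lt_card
  obtain ⟨p', h1, -, h3⟩ := exists_reduced hq p hN
  have hp' : p' ∈ Ideal.span (fieldEqs σ K (Nat.card k')) := by
    have := Ideal.sub_mem _ hp (constructible_le_span _ _ h3)
    simpa using this
  rw [eq_zero_of_mem_span_fieldEqs k' hp' h1, sub_zero] at h3
  exact h3

end Reduction

/-! ### Base change from `k'` to `k` -/

section BaseChange

variable {σ k' k : Type*} [Field k'] [Field k] [Algebra k' k]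

/-- The polynomial obtained by applying the `k'`-linear functional `l` to every coefficient. -/
noncomputable def coeffwise (l : k →ₗ[k'] k') (p : MvPolynomial σ k) : MvPolynomial σ k' :=
  AddMonoidAlgebra.map l.toAddMonoidHom p

@[simp]
theorem coeff_coeffwise (l : k →ₗ[k'] k') (p : MvPolynomial σ k) (s : σ →₀ ℕ) :
    coeff s (coeffwise l p) = l (coeff s p) :=
  rfl

theorem totalDegree_map_le {R S : Type*} [CommSemiring R] [CommSemiring S] (f : R →+* S)
    (p : MvPolynomial σ R) : (map f p).totalDegree ≤ p.totalDegree :=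
  Finset.sup_mono (support_map_subset f p)

theorem coeffwise_add (l : k →ₗ[k'] k') (p p' : MvPolynomial σ k) :
    coeffwise l (p + p') = coeffwise l p + coeffwise l p' := by
  ext s; simp

theorem coeffwise_sum {ι : Type*} (l : k →ₗ[k'] k') (s : Finset ι) (p : ι → MvPolynomial σ k) :
    coeffwise l (∑ i ∈ s, p i) = ∑ i ∈ s, coeffwise l (p i) := by
  ext; simp [coeff_sum]

theorem coeffwise_C_mul (l : k →ₗ[k'] k') (c : k) (p : MvPolynomial σ k) :
    coeffwise l (C c * p) = coeffwise (l ∘ₗ LinearMap.mulLeft k' c) p := by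
  ext s; simp

theorem coeffwise_mul_map (l : k →ₗ[k'] k') (g : MvPolynomial σ k) (h : MvPolynomial σ k') :
    coeffwise l (g * map (algebraMap k' k) h) = coeffwise l g * h := by
  classical
  ext s
  simp only [coeff_coeffwise, coeff_mul, map_sum, coeff_map]
  refine Finset.sum_congr rfl fun x _ => ?_
  rw [mul_comm, ← Algebra.smul_def, map_smul, smul_eq_mul, mul_comm]

theorem coeffwise_map (l : k →ₗ[k'] k') (h : MvPolynomial σ k') :
    coeffwise l (map (algebraMap k' k) h) = C (l 1) * h := by
  ext s
  rw [coeff_coeffwise, coeff_map, coeff_C_mul, Algebra.algebraMap_eq_smul_one, map_smul,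
    smul_eq_mul, mul_comm]

theorem totalDegree_coeffwise_le (l : k →ₗ[k'] k') (p : MvPolynomial σ k) :
    (coeffwise l p).totalDegree ≤ p.totalDegree := by
  refine Finset.sup_mono fun s hs => ?_
  rw [mem_support_iff, coeff_coeffwise] at hs
  rw [mem_support_iff]
  rintro h
  simp [h] at hs

theorem sum_C_mul_map_coeffwise_coord {ι : Type*} [Fintype ι] (α : Module.Basis ι k' k)
    (p : MvPolynomial σ k) :
    ∑ j, C (α j) * map (algebraMap k' k) (coeffwise (α.coord j) p) = p := by
  ext s
  rw [coeff_sum]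
  simp only [coeff_C_mul, coeff_map, coeff_coeffwise, Module.Basis.coord_apply]
  conv_rhs => rw [← α.sum_repr (coeff s p)]
  exact Finset.sum_congr rfl fun j _ => by rw [Algebra.smul_def, mul_comm]

/-- The spaces `V_{E,N}` descend along the extension of scalars from `k'` to `k`. -/
theorem mem_constructible_of_map_mem {ι : Type*} [Fintype ι] (α : Module.Basis ι k' k)
    {E : Set (MvPolynomial σ k')} {N : ℕ} {g : MvPolynomial σ k'}
    (hg : map (algebraMap k' k) g ∈ constructible (map (algebraMap k' k) '' E) N) :
    g ∈ constructible E N := by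
  -- The polynomials over `k` whose images under all functionals lie in `V_{E,N}` form a
  -- `k`-subspace that is closed in degree `N`.
  let W : Submodule k (MvPolynomial σ k) :=
    { carrier := {p | ∀ l : k →ₗ[k'] k', coeffwise l p ∈ constructible E N}
      add_mem' := fun ha hb l => by
        rw [coeffwise_add]; exact add_mem (ha l) (hb l)
      zero_mem' := fun l => by
        have : coeffwise l (0 : MvPolynomial σ k) = 0 := by ext; simp
        rw [this]; exact zero_mem _
      smul_mem' := fun c p hp l => by
        rw [smul_eq_C_mul, coeffwise_C_mul]; exact hp _ }
  have hW : IsClosedInDegree (map (algebraMap k' k) '' E) N W := by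
    constructor
    · rintro _ ⟨e, he, rfl⟩ hd l
      have hd' : e.totalDegree ≤ N := by
        rwa [totalDegree, support_map_of_injective _ (algebraMap k' k).injective,
          ← totalDegree] at hd
      rw [coeffwise_map, ← smul_eq_C_mul]
      exact Submodule.smul_mem _ _ (mem_constructible_of_mem he hd')
    · intro p hp h hd l
      by_cases hp0 : p = 0
      · rw [hp0, zero_mul, ← hp0]; exact hp l
      by_cases hh0 : h = 0
      · rw [hh0, mul_zero]; exact W.zero_mem l
      rw [totalDegree_mul_of_isDomain hp0 hh0] at hd
      have heq : p * h = ∑ j, C (α j) * (p * map (algebraMap k' k)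
          (coeffwise (α.coord j) h)) := by
        conv_lhs => rw [← sum_C_mul_map_coeffwise_coord α h]
        rw [Finset.mul_sum]
        exact Finset.sum_congr rfl fun j _ => by ring
      rw [heq, coeffwise_sum]
      refine sum_mem fun j _ => ?_
      rw [coeffwise_C_mul, coeffwise_mul_map]
      refine mul_mem_constructible (hp _) _ ((totalDegree_mul _ _).trans ?_)
      exact (add_le_add (totalDegree_coeffwise_le _ _) (totalDegree_coeffwise_le _ _)).trans hd
  obtain ⟨l, hl⟩ : ∃ l : k →ₗ[k'] k', l 1 = 1 := by
    obtain ⟨l, hl⟩ := LinearMap.exists_leftInverse_of_injective (Algebra.linearMap k' k)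
      (LinearMap.ker_eq_bot.2 (algebraMap k' k).injective)
    exact ⟨l, by simpa using congrArg (fun m => m 1) hl⟩
  have := (isLeast_constructible _ N).2 hW hg l
  rwa [coeffwise_map, hl, C_1, one_mul] at this

variable (k' k) in
theorem map_fieldEqs (q : ℕ) : map (algebraMap k' k) '' fieldEqs σ k' q =
    fieldEqs σ k q := by
  rw [fieldEqs, ← Set.range_comp, fieldEqs]
  congr 1
  ext j : 1
  simp

theorem map_mem_span_fieldEqs {q : ℕ} {p : MvPolynomial σ k'}
    (hp : p ∈ Ideal.span (fieldEqs σ k' q)) :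
    map (algebraMap k' k) p ∈ Ideal.span (fieldEqs σ k q) := by
  rw [← map_fieldEqs k' k, ← Ideal.map_span]
  exact Ideal.mem_map_of_mem _ hp

end BaseChange

/-! ### Conjugate linear forms and digit monomials -/

section Frobenius

variable {k' k : Type*} [Field k'] [Field k] [Algebra k' k]
  {n : ℕ} (α : Module.Basis (Fin n) k' k)

/-- The `i`-th conjugate `Y_i = ∑ j, α_j ^ (q ^ i) X_j` of the generic element `∑ j, α_j X_j`. It is
defined for all `i : ℕ`, and is periodic in `i` with period `n`. -/
noncomputable def conjForm (i : ℕ) : MvPolynomial (Fin n) k :=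
  ∑ j, C (α j ^ Nat.card k' ^ i) * X j

theorem conjForm_zero : conjForm α 0 = ∑ j, C (α j) * X j := by
  simp [conjForm]

theorem totalDegree_conjForm_le (i : ℕ) : (conjForm α i).totalDegree ≤ 1 := by
  refine totalDegree_finsetSum_le fun j _ => ?_
  exact (totalDegree_mul _ _).trans (by rw [totalDegree_C, totalDegree_X])

theorem totalDegree_conjForm_pow_le (i a : ℕ) : (conjForm α i ^ a).totalDegree ≤ a :=
  (totalDegree_pow _ _).trans (by have := totalDegree_conjForm_le α i; nlinarith)

variable [Finite k']

variable (k') in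
theorem sum_pow_card {R : Type*} [CommRing R] [Algebra k' R] {ι : Type*} (s : Finset ι)
    (g : ι → R) : (∑ i ∈ s, g i) ^ Nat.card k' = ∑ i ∈ s, g i ^ Nat.card k' := by
  have := Fintype.ofFinite k'
  rw [Nat.card_eq_fintype_card]
  exact map_sum (FiniteField.frobeniusAlgHom k' R) g s

theorem conjForm_pow_card_sub (i : ℕ) :
    conjForm α i ^ Nat.card k' - conjForm α (i + 1) =
      ∑ j, (α j ^ Nat.card k' ^ (i + 1)) • (X j ^ Nat.card k' - X j) := by
  rw [conjForm, sum_pow_card k', conjForm, ← Finset.sum_sub_distrib]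
  refine Finset.sum_congr rfl fun j _ => ?_
  rw [mul_pow, ← C_pow, ← pow_mul, ← pow_succ, smul_eq_C_mul, mul_sub]

theorem conjForm_pow_card_sub_mem_span (i : ℕ) :
    conjForm α i ^ Nat.card k' - conjForm α (i + 1) ∈
      Ideal.span (fieldEqs (Fin n) k (Nat.card k')) := by
  rw [conjForm_pow_card_sub]
  exact sum_mem fun j _ => by
    rw [smul_eq_C_mul]; exact Ideal.mul_mem_left _ _ (Ideal.subset_span ⟨j, rfl⟩)

theorem conjForm_pow_card_sub_mem {N : ℕ} (hN : Nat.card k' ≤ N) (i : ℕ) :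
    conjForm α i ^ Nat.card k' - conjForm α (i + 1) ∈
      constructible (fieldEqs (Fin n) k (Nat.card k')) N := by
  rw [conjForm_pow_card_sub]
  exact sum_mem fun j _ => Submodule.smul_mem _ _ (mem_constructible_of_mem ⟨j, rfl⟩
    ((totalDegree_X_pow_sub_X_le Nat.card_pos j).trans hN))

theorem totalDegree_conjForm_pow_card_sub_le (i : ℕ) :
    (conjForm α i ^ Nat.card k' - conjForm α (i + 1)).totalDegree ≤ Nat.card k' :=
  (totalDegree_sub _ _).trans (max_le (totalDegree_conjForm_pow_le α i _)
    ((totalDegree_conjForm_le α _).trans Nat.card_pos))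

theorem pow_card_pow_eq_self (α : Module.Basis (Fin n) k' k) (x : k) :
    x ^ Nat.card k' ^ n = x := by
  have : Module.Finite k' k := Module.Finite.of_basis α
  have : Finite k := Module.finite_of_finite k'
  have := Fintype.ofFinite k
  have hcard : Nat.card k' ^ n = Fintype.card k := by
    rw [← Nat.card_eq_fintype_card, Module.natCard_eq_pow_finrank (K := k') (V := k),
      Module.finrank_eq_card_basis α, Fintype.card_fin]
  rw [hcard, FiniteField.pow_card]

theorem conjForm_n : conjForm α n = conjForm α 0 := by
  simp [conjForm, pow_card_pow_eq_self α]

end Frobenius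

theorem lt_of_mem_support_of_degree_lt {R : Type*} [Semiring R] {p : Polynomial R} {D m : ℕ}
    (hp : p.degree < D) (hm : m ∈ p.support) : m < D := by
  have := (Polynomial.le_degree_of_mem_supp m hm).trans_lt hp
  exact_mod_cast this

section Digits

variable {k' k : Type*} [Field k'] [Field k] [Algebra k' k]
  {n : ℕ} (α : Module.Basis (Fin n) k' k)

/-- The product of the powers `Y_i ^ d_0 * Y_{i+1} ^ d_1 * ⋯` with exponents from a list `d`. -/
noncomputable def conjProd : List ℕ → ℕ → MvPolynomial (Fin n) k
  | [], _ => 1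
  | d :: l, i => conjForm α i ^ d * conjProd l (i + 1)

/-- The monomial `Y_i ^ m_0 * Y_{i+1} ^ m_1 * ⋯` attached to the base `q` digits `m_0, m_1, …` of
`m`; it represents the power `Y_i ^ m` modulo the field equations, in low degree. -/
noncomputable def digitMonomial (i m : ℕ) : MvPolynomial (Fin n) k :=
  conjProd α (Nat.digits (Nat.card k') m) i

@[simp]
theorem digitMonomial_zero (i : ℕ) : digitMonomial α i 0 = 1 := by
  simp [digitMonomial, conjProd]

/-- The `k`-linear map `k[T] → k[X_0, …, X_{n-1}]` that sends `T ^ m` to the product of the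
conjugate forms `Y_0, Y_1, …` with the base `q` digits of `m` as exponents. -/
noncomputable def digitLift : Polynomial k →ₗ[k] MvPolynomial (Fin n) k :=
  (Polynomial.basisMonomials k).constr k (digitMonomial α 0)

theorem digitLift_monomial (m : ℕ) (c : k) :
    digitLift α (Polynomial.monomial m c) = c • digitMonomial α 0 m := by
  have h := (Polynomial.basisMonomials k).constr_basis k (digitMonomial α 0) m
  rw [Polynomial.coe_basisMonomials] at h
  rw [← mul_one c, ← smul_eq_mul, ← Polynomial.smul_monomial, map_smul, digitLift, h, smul_eq_mul,
    mul_one]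

theorem digitLift_C_mul_X_pow (m : ℕ) (c : k) :
    digitLift α (Polynomial.C c * Polynomial.X ^ m) = c • digitMonomial α 0 m := by
  rw [Polynomial.C_mul_X_pow_eq_monomial, digitLift_monomial]

theorem digitLift_C (c : k) : digitLift α (Polynomial.C c) = C c := by
  rw [← Polynomial.monomial_zero_left, digitLift_monomial, digitMonomial_zero, smul_eq_C_mul,
    mul_one]

theorem digitLift_eq_sum (p : Polynomial k) :
    digitLift α p = ∑ m ∈ p.support, p.coeff m • digitMonomial α 0 m := by
  conv_lhs => rw [p.as_sum_support]
  simp [digitLift_monomial]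

variable [Finite k']

theorem digitMonomial_eq (i m : ℕ) : digitMonomial α i m =
    conjForm α i ^ (m % Nat.card k') * digitMonomial α (i + 1) (m / Nat.card k') := by
  rcases Nat.eq_zero_or_pos m with rfl | hm
  · simp
  · rw [digitMonomial, Nat.digits_def' Finite.one_lt_card hm, conjProd, digitMonomial]

theorem digitMonomial_add_mul {r : ℕ} (hr : r < Nat.card k') (i m : ℕ) :
    digitMonomial α i (r + Nat.card k' * m) = conjForm α i ^ r * digitMonomial α (i + 1) m := by
  rw [digitMonomial_eq, Nat.add_mul_mod_self_left, Nat.mod_eq_of_lt hr,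
    Nat.add_mul_div_left _ _ Nat.card_pos, Nat.div_eq_of_lt hr, zero_add]

theorem totalDegree_digitMonomial_le (t : ℕ) : ∀ i m : ℕ, m < Nat.card k' ^ t →
    (digitMonomial α i m).totalDegree ≤ (Nat.card k' - 1) * t := by
  have hpos : 0 < Nat.card k' := Nat.card_pos
  induction t with
  | zero =>
    intro i m hm
    obtain rfl : m = 0 := by simpa using hm
    simp
  | succ t ih =>
    intro i m hm
    have h1 := ih (i + 1) (m / Nat.card k') (Nat.div_lt_of_lt_mul (by rwa [← pow_succ']))
    have h2 := Nat.mod_lt m hpos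
    have h3 := totalDegree_conjForm_pow_le α i (m % Nat.card k')
    rw [digitMonomial_eq, mul_add, mul_one]
    refine (totalDegree_mul _ _).trans ?_
    omega

theorem digitMonomial_pow (θ i : ℕ) :
    digitMonomial α i (Nat.card k' ^ θ) = conjForm α (i + θ) := by
  have hq : 1 < Nat.card k' := Finite.one_lt_card
  induction θ generalizing i with
  | zero => simpa using digitMonomial_add_mul α hq i 0
  | succ θ ih =>
    have := digitMonomial_add_mul α (by omega : 0 < Nat.card k') i (Nat.card k' ^ θ)
    rw [zero_add, ← pow_succ', pow_zero, one_mul, ih] at this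
    rw [this]
    congr 1
    omega

/-- The exponents `q ^ θ + q ^ φ` have at most two nonzero base `q` digits counted with
multiplicity. For `q = 2` and `θ = φ` the two ones carry. -/
theorem totalDegree_digitMonomial_pow_add_pow_le (θ φ i : ℕ) :
    (digitMonomial α i (Nat.card k' ^ θ + Nat.card k' ^ φ)).totalDegree ≤ 2 := by
  have hq : 1 < Nat.card k' := Finite.one_lt_card
  wlog hle : θ ≤ φ generalizing θ φ
  · rw [add_comm]; exact this φ θ (by omega)
  induction θ generalizing i φ with
  | zero =>
    rcases φ with _ | φ
    · rcases (by omega : Nat.card k' = 2 ∨ 2 < Nat.card k') with h2 | h2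
      · have := digitMonomial_pow α 1 i
        rw [pow_one, h2] at this
        rw [pow_zero, one_add_one_eq_two, this]
        exact (totalDegree_conjForm_le α _).trans (by norm_num)
      · have := digitMonomial_add_mul α h2 i 0
        rw [mul_zero, digitMonomial_zero, mul_one, add_zero] at this
        rw [pow_zero, one_add_one_eq_two, this]
        exact totalDegree_conjForm_pow_le α i 2
    · rw [pow_zero, pow_succ', digitMonomial_add_mul α hq, digitMonomial_pow]
      refine (totalDegree_mul _ _).trans ?_
      have h1 := totalDegree_conjForm_pow_le α i 1
      have h2 := totalDegree_conjForm_le α (i + 1 + φ)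
      omega
  | succ θ ih =>
    rcases φ with _ | φ
    · omega
    · have := digitMonomial_add_mul α (by omega : 0 < Nat.card k') i
        (Nat.card k' ^ θ + Nat.card k' ^ φ)
      rw [zero_add, mul_add, ← pow_succ', ← pow_succ', pow_zero, one_mul] at this
      rw [this]
      exact ih _ _ (by omega)

/-- Multiplication by `Y_i` is the successor on exponents: the carries are performed by the
relations `Y_j ^ q ≡ Y_{j+1}`, without leaving degree `(q - 1) t + 1`. -/
theorem conjForm_mul_digitMonomial_sub_mem {N : ℕ} (hN : Nat.card k' ≤ N) (t : ℕ) :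
    ∀ i m : ℕ, m < Nat.card k' ^ t → (Nat.card k' - 1) * t + 1 ≤ N →
      conjForm α i * digitMonomial α i m - digitMonomial α i (m + 1) ∈
        constructible (fieldEqs (Fin n) k (Nat.card k')) N := by
  have hq : 1 < Nat.card k' := Finite.one_lt_card
  induction t with
  | zero =>
    intro i m hm _
    obtain rfl : m = 0 := by simpa using hm
    have := digitMonomial_pow α 0 i
    rw [pow_zero, add_zero] at this
    simp [this]
  | succ t ih =>
    intro i m hm hd
    rw [mul_add, mul_one] at hd
    set q := Nat.card k' with hqdef
    have hdm : m % q + q * (m / q) = m := Nat.mod_add_div m q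
    have hr : m % q < q := Nat.mod_lt m (by omega)
    have hlt : m / q < q ^ t := Nat.div_lt_of_lt_mul (by rwa [← pow_succ'])
    rw [digitMonomial_eq α i m, ← mul_assoc, ← pow_succ', ← hqdef]
    rcases (by omega : m % q + 1 < q ∨ m % q + 1 = q) with h | h
    · have := digitMonomial_add_mul α h i (m / q)
      rw [← hqdef] at this
      rw [show m + 1 = m % q + 1 + q * (m / q) by omega, this, sub_self]
      exact zero_mem _
    · have hdeg : (digitMonomial α (i + 1) (m / q)).totalDegree ≤ (q - 1) * t :=
        totalDegree_digitMonomial_le α t (i + 1) _ hlt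
      have h0 := digitMonomial_add_mul α (by omega : 0 < q) i (m / q + 1)
      rw [← hqdef, zero_add, pow_zero, one_mul, mul_add, mul_one] at h0
      rw [show m + 1 = q * (m / q) + q by omega, h0, h]
      have h1 : digitMonomial α (i + 1) (m / q) * (conjForm α i ^ q - conjForm α (i + 1)) ∈
          constructible (fieldEqs (Fin n) k q) N :=
        mul_mem_constructible' (conjForm_pow_card_sub_mem α hN i)
          (totalDegree_conjForm_pow_card_sub_le α i) hdeg (by omega)
      have h2 := ih (i + 1) (m / q) hlt (by omega)
      have := add_mem h1 h2
      convert this using 1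
      ring

/-- Modulo the field equations, `digitMonomial α i m` is the power `Y_i ^ m`. -/
theorem digitMonomial_sub_pow_mem (m : ℕ) : ∀ i : ℕ,
    digitMonomial α i m - conjForm α i ^ m ∈
      Ideal.span (fieldEqs (Fin n) k (Nat.card k')) := by
  have hq : 1 < Nat.card k' := Finite.one_lt_card
  induction m using Nat.strong_induction_on with
  | _ m ih =>
    intro i
    rcases Nat.eq_zero_or_pos m with rfl | hm
    · simp
    · have h1 := ih (m / Nat.card k') (Nat.div_lt_self hm hq) (i + 1)
      have h2 := conjForm_pow_card_sub_mem_span α i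
      rw [← Ideal.Quotient.eq] at h1 h2 ⊢
      rw [digitMonomial_eq, map_mul, h1]
      conv_rhs => rw [← Nat.mod_add_div m (Nat.card k')]
      rw [pow_add, pow_mul, map_mul, map_pow _ (conjForm α i ^ Nat.card k'), h2,
        map_pow _ _ (m / _)]

theorem totalDegree_digitLift_le {t : ℕ} {p : Polynomial k}
    (hp : p.degree < (Nat.card k' ^ t : ℕ)) :
    (digitLift α p).totalDegree ≤ (Nat.card k' - 1) * t := by
  rw [digitLift_eq_sum]
  refine totalDegree_finsetSum_le fun m hm => (totalDegree_smul_le _ _).trans ?_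
  exact totalDegree_digitMonomial_le α t 0 m (lt_of_mem_support_of_degree_lt hp hm)

theorem conjForm_mul_digitLift_sub_mem {N t : ℕ} (hN : Nat.card k' ≤ N)
    (hd : (Nat.card k' - 1) * t + 1 ≤ N) {p : Polynomial k}
    (hp : p.degree < (Nat.card k' ^ t : ℕ)) :
    conjForm α 0 * digitLift α p - digitLift α (Polynomial.X * p) ∈
      constructible (fieldEqs (Fin n) k (Nat.card k')) N := by
  have h : digitLift α (Polynomial.X * p) =
      ∑ m ∈ p.support, p.coeff m • digitMonomial α 0 (m + 1) := by
    conv_lhs => rw [p.as_sum_support]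
    simp [Finset.mul_sum, Polynomial.X_mul_monomial, digitLift_monomial]
  rw [h, digitLift_eq_sum, Finset.mul_sum, ← Finset.sum_sub_distrib]
  refine sum_mem fun m hm => ?_
  rw [mul_smul_comm, ← smul_sub]
  exact Submodule.smul_mem _ _
    (conjForm_mul_digitMonomial_sub_mem α hN t 0 m (lt_of_mem_support_of_degree_lt hp hm) hd)

theorem digitLift_sub_aeval_mem (p : Polynomial k) :
    digitLift α p - Polynomial.aeval (conjForm α 0) p ∈
      Ideal.span (fieldEqs (Fin n) k (Nat.card k')) := by
  rw [digitLift_eq_sum, Polynomial.aeval_def, Polynomial.eval₂_eq_sum, Polynomial.sum_def,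
    ← Finset.sum_sub_distrib]
  refine sum_mem fun m _ => ?_
  rw [← Algebra.smul_def, ← smul_sub, smul_eq_C_mul]
  exact Ideal.mul_mem_left _ _ (digitMonomial_sub_pow_mem α m 0)

end Digits

/-! ### Reduction modulo a univariate polynomial inside `V_{E,N}` -/

section Remainder

variable {k' k : Type*} [Field k'] [Field k] [Algebra k' k]
  {n : ℕ} (α : Module.Basis (Fin n) k' k)

/-- The `k`-linear map that sends `p` to the digit lift of the remainder of `p` modulo `f`. -/
noncomputable def remLift (f : Polynomial k) : Polynomial k →ₗ[k] MvPolynomial (Fin n) k :=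
  digitLift α ∘ₗ Polynomial.modByMonicHom (f * Polynomial.C f.leadingCoeff⁻¹)

theorem remLift_apply (f p : Polynomial k) : remLift α f p = digitLift α (p % f) := by
  rw [Polynomial.mod_def]; rfl

theorem remLift_eq_of_dvd_sub {f p p' : Polynomial k} (h : f ∣ p - p') :
    remLift α f p = remLift α f p' := by
  rw [remLift_apply, remLift_apply, Polynomial.mod_eq_of_dvd_sub h]

theorem dvd_mod_sub (f p : Polynomial k) : f ∣ p % f - p :=
  ⟨-(p / f), by linear_combination EuclideanDomain.div_add_mod p f⟩

theorem remLift_mul_mod (f p r : Polynomial k) :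
    remLift α f (p * (r % f)) = remLift α f (p * r) :=
  remLift_eq_of_dvd_sub α (by rw [← mul_sub]; exact Dvd.dvd.mul_left (dvd_mod_sub f r) p)

/-- Among the polynomials of degree at most `deg f`, the remainder modulo `f` only subtracts a scalar
multiple of `f`. -/
theorem digitLift_sub_remLift_mem {f : Polynomial k} (hf : f ≠ 0)
    {V : Submodule k (MvPolynomial (Fin n) k)} (hV : digitLift α f ∈ V) {p : Polynomial k}
    (hp : p.degree ≤ f.degree) : digitLift α p - remLift α f p ∈ V := by
  rw [remLift_apply, ← map_sub]
  rcases hp.lt_or_eq with h | h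
  · rw [(Polynomial.mod_eq_self_iff hf).2 h, sub_self, map_zero]
    exact zero_mem _
  · have hdiv := Polynomial.degree_add_div hf h.ge
    obtain ⟨c, hc⟩ : ∃ c, p / f = Polynomial.C c := by
      refine ⟨_, Polynomial.eq_C_of_degree_le_zero ?_⟩
      rw [h, Polynomial.degree_eq_natDegree hf] at hdiv
      by_cases h0 : p / f = 0
      · simp [h0]
      · rw [Polynomial.degree_eq_natDegree h0] at hdiv ⊢
        norm_cast at hdiv ⊢
        omega
    have : p - p % f = c • f := by
      rw [Polynomial.smul_eq_C_mul, ← hc]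
      linear_combination -EuclideanDomain.div_add_mod p f
    rw [this, map_smul]
    exact Submodule.smul_mem _ _ hV

variable [Finite k']

theorem totalDegree_remLift_le {f : Polynomial k} (hf : f ≠ 0) {t : ℕ}
    (hdeg : f.natDegree ≤ Nat.card k' ^ t) (p : Polynomial k) :
    (remLift α f p).totalDegree ≤ (Nat.card k' - 1) * t := by
  rw [remLift_apply]
  refine totalDegree_digitLift_le α ((EuclideanDomain.mod_lt p hf).trans_le ?_)
  rw [Polynomial.degree_eq_natDegree hf]
  exact_mod_cast hdeg

/-- If `V_{E,N}` contains the field equations and a representative of `f`, then multiplication by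
`Y_i` acts on the representatives of remainders modulo `f` as multiplication by `T ^ (q ^ i)`. In the
step from `i` to `i + 1`, `Y_{i+1}` is replaced by `Y_i ^ q` and the factors `Y_i` are absorbed one
at a time, so that the degrees never exceed `q + (q - 1) t`. -/
theorem conjForm_mul_remLift_sub_mem {E : Set (MvPolynomial (Fin n) k)}
    (hE : fieldEqs (Fin n) k (Nat.card k') ⊆ E) {f : Polynomial k} (hf : f ≠ 0) {t N : ℕ}
    (hdeg : f.natDegree ≤ Nat.card k' ^ t) (hN : (Nat.card k' - 1) * (t + 1) + 1 ≤ N)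
    (hV : digitLift α f ∈ constructible E N) (i : ℕ) : ∀ p : Polynomial k,
      conjForm α i * remLift α f p - remLift α f (Polynomial.X ^ Nat.card k' ^ i * p) ∈
        constructible E N := by
  have hq : 1 < Nat.card k' := Finite.one_lt_card
  rw [mul_add, mul_one] at hN
  have hrem := fun p => totalDegree_remLift_le α hf hdeg p
  induction i with
  | zero =>
    intro p
    have hlt : (p % f).degree < f.degree := EuclideanDomain.mod_lt p hf
    have hlt' : (p % f).degree < (Nat.card k' ^ t : ℕ) := by
      refine hlt.trans_le ?_
      rw [Polynomial.degree_eq_natDegree hf]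
      exact_mod_cast hdeg
    have h1 := constructible_mono hE
      (conjForm_mul_digitLift_sub_mem α (N := N) (t := t) (by omega) (by omega) hlt')
    have h2 : (Polynomial.X * (p % f)).degree ≤ f.degree := by
      rw [mul_comm, Polynomial.degree_mul_X]
      exact Nat.WithBot.add_one_le_of_lt hlt
    have h3 := add_mem h1 (digitLift_sub_remLift_mem α hf hV h2)
    rw [remLift_mul_mod, sub_add_sub_cancel] at h3
    rwa [remLift_apply, pow_zero, pow_one]
  | succ i ih =>
    intro p
    have hpow : ∀ a : ℕ, a ≤ Nat.card k' →
        conjForm α i ^ a * remLift α f p -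
          remLift α f (Polynomial.X ^ (Nat.card k' ^ i * a) * p) ∈ constructible E N := by
      intro a
      induction a with
      | zero => intro _; simp
      | succ a iha =>
        intro ha
        have hdiff : (conjForm α i ^ a * remLift α f p -
            remLift α f (Polynomial.X ^ (Nat.card k' ^ i * a) * p)).totalDegree ≤
              a + (Nat.card k' - 1) * t := by
          refine (totalDegree_sub _ _).trans (max_le ((totalDegree_mul _ _).trans ?_) ?_)
          · exact add_le_add (totalDegree_conjForm_pow_le α i a) (hrem p)
          · exact (hrem _).trans (by omega)
        have h1 := mul_mem_constructible' (iha (by omega)) hdiff (totalDegree_conjForm_le α i)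
          (by omega)
        have h2 := add_mem h1 (ih (Polynomial.X ^ (Nat.card k' ^ i * a) * p))
        rw [← mul_assoc (Polynomial.X ^ _), ← pow_add] at h2
        convert h2 using 1
        rw [mul_add, mul_one, add_comm (_ * a)]
        ring
    have h1 := hpow _ le_rfl
    rw [← pow_succ] at h1
    have h2 : remLift α f p * (conjForm α i ^ Nat.card k' - conjForm α (i + 1)) ∈
        constructible E N :=
      mul_mem_constructible' (constructible_mono hE (conjForm_pow_card_sub_mem α (by omega) i))
        (totalDegree_conjForm_pow_card_sub_le α i) (hrem p) (by omega)
    have h3 := sub_mem h1 h2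
    convert h3 using 1
    ring

end Remainder

/-! ### The univariate polynomial attached to a multivariate one -/

section Univariate

variable {k' k : Type*} [Field k'] [Field k] [Algebra k' k]
  {n : ℕ} (α : Module.Basis (Fin n) k' k)

/-- The element `∑_{i < n} δ ^ (q ^ i) T ^ (q ^ i)` of `k[T]`, the formal trace of `δ T`. -/
noncomputable def tracePoly (k' : Type*) [Field k'] {k : Type*} [Field k] (n : ℕ) (δ : k) :
    Polynomial k :=
  ∑ i ∈ Finset.range n, Polynomial.C (δ ^ Nat.card k' ^ i) * Polynomial.X ^ Nat.card k' ^ i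

section

variable {α} {δ : Fin n → k}

theorem X_eq_sum_conjForm
    (hδ : ∀ j l, ∑ i ∈ Finset.range n, δ j ^ Nat.card k' ^ i * α l ^ Nat.card k' ^ i =
      if j = l then 1 else 0) (j : Fin n) :
    (X j : MvPolynomial (Fin n) k) =
      ∑ i ∈ Finset.range n, (δ j ^ Nat.card k' ^ i) • conjForm α i := by
  simp only [conjForm, smul_eq_C_mul, Finset.mul_sum]
  rw [Finset.sum_comm]
  have : ∀ l, ∑ i ∈ Finset.range n, C (δ j ^ Nat.card k' ^ i) *
      (C (α l ^ Nat.card k' ^ i) * X l : MvPolynomial (Fin n) k) =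
        C (if j = l then 1 else 0) * X l := fun l => by
    rw [← hδ j l, map_sum, Finset.sum_mul]
    exact Finset.sum_congr rfl fun i _ => by rw [← mul_assoc, C_mul]
  rw [Finset.sum_congr rfl fun l _ => this l]
  simp

theorem sum_C_mul_tracePoly
    (hδ : ∀ i ∈ Finset.range n, ∑ j, α j * δ j ^ Nat.card k' ^ i = if i = 0 then 1 else 0) :
    ∑ j, Polynomial.C (α j) * tracePoly k' n (δ j) = Polynomial.X := by
  have hn : n ≠ 0 := by
    rintro rfl
    exact one_ne_zero (α.repr.injective (Subsingleton.elim (α.repr 1) (α.repr 0)))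
  simp only [tracePoly, Finset.mul_sum]
  rw [Finset.sum_comm]
  have : ∀ i ∈ Finset.range n, ∑ j, Polynomial.C (α j) *
      (Polynomial.C (δ j ^ Nat.card k' ^ i) * Polynomial.X ^ Nat.card k' ^ i) =
        Polynomial.C (if i = 0 then 1 else 0) * Polynomial.X ^ Nat.card k' ^ i := fun i hi => by
    rw [← hδ i hi, map_sum, Finset.sum_mul]
    exact Finset.sum_congr rfl fun j _ => by rw [← mul_assoc, Polynomial.C_mul]
  rw [Finset.sum_congr rfl this, Finset.sum_eq_single 0]
  · simp
  · intro i _ hi; simp [hi]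
  · simp [hn]

end

variable [Finite k']

/-- The dual basis `δ` of `α` under the trace form. The first identity spells out
`Tr (δ_j α_l) = [j = l]`. It says that the square matrices with entries `δ_j ^ (q ^ i)`, at `(j, i)`,
and `α_l ^ (q ^ i)`, at `(i, l)`, are inverse to each other; the second identity is row `0` of their
product in the other order. -/
theorem exists_dual : ∃ δ : Fin n → k,
    (∀ j l, ∑ i ∈ Finset.range n, δ j ^ Nat.card k' ^ i * α l ^ Nat.card k' ^ i =
      if j = l then 1 else 0) ∧
    ∀ i ∈ Finset.range n, ∑ j, α j * δ j ^ Nat.card k' ^ i = if i = 0 then 1 else 0 := by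
  have : Module.Finite k' k := Module.Finite.of_basis α
  have : Finite k := Module.finite_of_finite k'
  have h1 : ∀ j l, ∑ i ∈ Finset.range n,
      α.traceDual j ^ Nat.card k' ^ i * α l ^ Nat.card k' ^ i = if j = l then 1 else 0 := by
    intro j l
    have h := FiniteField.algebraMap_trace_eq_sum_pow k' k (α.traceDual j * α l)
    rw [Module.Basis.trace_traceDual_mul, Module.finrank_eq_card_basis α, Fintype.card_fin] at h
    simp only [← mul_pow]
    rw [← h]
    by_cases hjl : j = l
    · simp [hjl]
    · simp [hjl, Ne.symm hjl]
  refine ⟨α.traceDual, h1, fun i hi => ?_⟩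
  let A : Matrix (Fin n) (Fin n) k := fun j i => α.traceDual j ^ Nat.card k' ^ (i : ℕ)
  let B : Matrix (Fin n) (Fin n) k := fun i j => α j ^ Nat.card k' ^ (i : ℕ)
  have hAB : A * B = 1 := by
    ext j l
    rw [Matrix.mul_apply, Matrix.one_apply, ← h1 j l, Finset.sum_range]
  have hBA : B * A = 1 := mul_eq_one_comm.1 hAB
  have hi' := Finset.mem_range.1 hi
  have := congrFun (congrFun hBA ⟨0, by omega⟩) ⟨i, hi'⟩
  rw [Matrix.mul_apply, Matrix.one_apply] at this
  simpa [A, B, eq_comm] using this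

variable {α} {δ : Fin n → k}

/-- Raising to the power `q` permutes the summands of the trace cyclically modulo `T ^ (q ^ n) - T`. -/
theorem tracePoly_pow_card_sub_mem (α : Module.Basis (Fin n) k' k) (δ : k) :
    tracePoly k' n δ ^ Nat.card k' - tracePoly k' n δ ∈
      Ideal.span {(Polynomial.X ^ Nat.card k' ^ n - Polynomial.X : Polynomial k)} := by
  have h : tracePoly k' n δ ^ Nat.card k' = ∑ i ∈ Finset.range n,
      Polynomial.C (δ ^ Nat.card k' ^ (i + 1)) * Polynomial.X ^ Nat.card k' ^ (i + 1) := by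
    rw [tracePoly, sum_pow_card k']
    refine Finset.sum_congr rfl fun i _ => ?_
    rw [mul_pow, ← Polynomial.C_pow, ← pow_mul, ← pow_mul, ← pow_succ]
  rw [h, tracePoly, ← Finset.sum_sub_distrib, Finset.sum_range_sub (fun i =>
    Polynomial.C (δ ^ Nat.card k' ^ i) * Polynomial.X ^ Nat.card k' ^ i),
    pow_card_pow_eq_self α, pow_zero, pow_one, pow_one, ← mul_sub]
  exact Ideal.mul_mem_left _ _ (Ideal.subset_span rfl)

/-- Every polynomial `g` of degree at most `N` is congruent modulo `V_{E,N}` to a representative of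
the remainder modulo `f` of the univariate polynomial attached to `g`. -/
theorem sub_remLift_aeval_mem {E : Set (MvPolynomial (Fin n) k)}
    (hE : fieldEqs (Fin n) k (Nat.card k') ⊆ E) {f : Polynomial k} (hf : f ≠ 0) {t N : ℕ}
    (hdeg : f.natDegree ≤ Nat.card k' ^ t) (hN : (Nat.card k' - 1) * (t + 1) + 1 ≤ N)
    (hV : digitLift α f ∈ constructible E N)
    (hδ : ∀ j l, ∑ i ∈ Finset.range n, δ j ^ Nat.card k' ^ i * α l ^ Nat.card k' ^ i =
      if j = l then 1 else 0) {g : MvPolynomial (Fin n) k} (hg : g.totalDegree ≤ N) :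
    g - remLift α f (aeval (fun j => tracePoly k' n (δ j)) g) ∈ constructible E N := by
  classical
  have hq : 1 < Nat.card k' := Finite.one_lt_card
  have hmon : ∀ (d : ℕ) (s : Fin n →₀ ℕ), s.degree = d → d ≤ N → monomial s (1 : k) -
      remLift α f (aeval (fun j => tracePoly k' n (δ j)) (monomial s (1 : k))) ∈
        constructible E N := by
    intro d
    induction d with
    | zero =>
      intro s hs _
      obtain rfl : s = 0 := (Finsupp.degree_eq_zero_iff s).1 hs
      have h1 : (Polynomial.C (1 : k)).degree ≤ f.degree := by
        rw [Polynomial.degree_C one_ne_zero]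
        exact Polynomial.zero_le_degree_iff.2 hf
      have := digitLift_sub_remLift_mem α hf hV h1
      rw [digitLift_C] at this
      simpa using this
    | succ d ih =>
      intro s hs hd
      obtain ⟨j, hj⟩ : ∃ j, s j ≠ 0 := by
        by_contra! h
        rw [show s = 0 from Finsupp.ext h] at hs
        simp at hs
      obtain ⟨u, rfl⟩ : ∃ u, s = Finsupp.single j 1 + u :=
        ⟨s - Finsupp.single j 1,
          (add_tsub_cancel_of_le (Finsupp.single_le_iff.2 (by omega))).symm⟩
      rw [map_add, Finsupp.degree_single] at hs
      have hu := ih u (by omega) (by omega)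
      set p := aeval (fun j => tracePoly k' n (δ j)) (monomial u (1 : k)) with hp
      rw [monomial_single_add, pow_one, map_mul, aeval_X, ← hp]
      have hdiff : (monomial u (1 : k) - remLift α f p).totalDegree ≤ N - 1 := by
        refine (totalDegree_sub _ _).trans (max_le ((totalDegree_monomial_le u _).trans ?_) ?_)
        · exact (by omega : u.degree ≤ N - 1)
        · refine (totalDegree_remLift_le α hf hdeg p).trans ?_
          rw [mul_add, mul_one] at hN
          omega
      have h1 := mul_mem_constructible' hu hdiff (totalDegree_X j).le (by omega)
      have h2 : X j * remLift α f p - remLift α f (tracePoly k' n (δ j) * p) ∈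
          constructible E N := by
        have he : remLift α f (tracePoly k' n (δ j) * p) = ∑ i ∈ Finset.range n,
            (δ j ^ Nat.card k' ^ i) • remLift α f (Polynomial.X ^ Nat.card k' ^ i * p) := by
          rw [tracePoly, Finset.sum_mul, map_sum]
          exact Finset.sum_congr rfl fun i _ => by
            rw [mul_assoc, ← Polynomial.smul_eq_C_mul, map_smul]
        rw [he, X_eq_sum_conjForm hδ j, Finset.sum_mul, ← Finset.sum_sub_distrib]
        refine sum_mem fun i _ => ?_
        rw [smul_mul_assoc, ← smul_sub]
        exact Submodule.smul_mem _ _ (conjForm_mul_remLift_sub_mem α hE hf hdeg hN hV i p)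
      have h3 := add_mem h1 h2
      convert h3 using 1
      ring
  have hsum : g = ∑ s ∈ g.support, coeff s g • monomial s (1 : k) := by
    conv_lhs => rw [g.as_sum]
    simp [smul_monomial]
  have key : g - remLift α f (aeval (fun j => tracePoly k' n (δ j)) g) =
      ∑ s ∈ g.support, coeff s g • (monomial s (1 : k) -
        remLift α f (aeval (fun j => tracePoly k' n (δ j)) (monomial s (1 : k)))) := by
    conv_lhs => rw [hsum]
    simp only [map_sum, map_smul, ← Finset.sum_sub_distrib, ← smul_sub]
  rw [key]
  exact sum_mem fun s hs => Submodule.smul_mem _ _ (hmon _ s rfl ((le_totalDegree hs).trans hg))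

/-- Every element of the ideal `(f, T ^ (q ^ n) - T)` has the same remainder modulo `f` as
`b T ^ (q ^ n) - b T` for some `b`. Its representative is congruent to the product of the
representative of `b` with `Y_n - Y_0 = 0`, hence lies in `V_{E,N}`. -/
theorem mem_constructible_of_aeval_mem {E : Set (MvPolynomial (Fin n) k)}
    (hE : fieldEqs (Fin n) k (Nat.card k') ⊆ E) {f : Polynomial k} (hf : f ≠ 0) {t N : ℕ}
    (hdeg : f.natDegree ≤ Nat.card k' ^ t) (hN : (Nat.card k' - 1) * (t + 1) + 1 ≤ N)
    (hV : digitLift α f ∈ constructible E N)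
    (hδ : ∀ j l, ∑ i ∈ Finset.range n, δ j ^ Nat.card k' ^ i * α l ^ Nat.card k' ^ i =
      if j = l then 1 else 0) {g : MvPolynomial (Fin n) k} (hg : g.totalDegree ≤ N)
    (hmem : aeval (fun j => tracePoly k' n (δ j)) g ∈
      Ideal.span {f, Polynomial.X ^ Nat.card k' ^ n - Polynomial.X}) :
    g ∈ constructible E N := by
  have h := sub_remLift_aeval_mem hE hf hdeg hN hV hδ hg
  obtain ⟨a, b, hab⟩ := Ideal.mem_span_pair.1 hmem
  have h1 : remLift α f (aeval (fun j => tracePoly k' n (δ j)) g) =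
      remLift α f (Polynomial.X ^ Nat.card k' ^ n * b) -
        remLift α f (Polynomial.X ^ Nat.card k' ^ 0 * b) := by
    rw [← map_sub]
    refine remLift_eq_of_dvd_sub α ⟨a, ?_⟩
    rw [← hab, pow_zero]
    ring
  have hB := conjForm_mul_remLift_sub_mem α hE hf hdeg hN hV
  have h2 := sub_mem (hB 0 b) (hB n b)
  rw [conjForm_n, sub_sub_sub_cancel_left, ← h1] at h2
  simpa using add_mem h h2

end Univariate

/-! ### Weil descent systems -/

section WeilDescentSystem

variable {k' k : Type*} [Field k'] [Finite k'] [Field k] [Algebra k' k]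
  {n : ℕ} (α : Module.Basis (Fin n) k' k)

theorem isWeilDescent_weilDescent (f : Polynomial k) : IsWeilDescent α f (weilDescent α f) :=
  (existsUnique_isWeilDescent α f).choose_spec.1

theorem IsWeilDescent.eq_weilDescent {f : Polynomial k} {c : Fin n → MvPolynomial (Fin n) k'}
    (hc : IsWeilDescent α f c) : c = weilDescent α f :=
  (existsUnique_isWeilDescent α f).choose_spec.2 c hc

theorem weilDescent_zero : weilDescent α 0 = 0 :=
  (IsWeilDescent.eq_weilDescent α ⟨fun i j => by simp, by simp⟩).symm

theorem weilDescentSystemWithFieldEqs_singleton (f : Polynomial k) :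
    weilDescentSystemWithFieldEqs α {f} =
      Set.range (weilDescent α f) ∪ fieldEqs (Fin n) k' (Nat.card k') := by
  ext g
  simp [weilDescentSystemWithFieldEqs, weilDescentSystem, fieldEqs, eq_comm]

theorem fieldEqs_subset_map_image (f : Polynomial k) : fieldEqs (Fin n) k (Nat.card k') ⊆
    map (algebraMap k' k) '' weilDescentSystemWithFieldEqs α {f} := by
  rw [weilDescentSystemWithFieldEqs_singleton, Set.image_union, map_fieldEqs]
  exact Set.subset_union_right

/-- If the digit lift of `f` has degree at most `N`, then so have the Weil descent components of `f`,
and the digit lift lies in the space `V_{E,N}` of the Weil descent system over `k`. -/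
theorem digitLift_mem_constructible (f : Polynomial k) {N : ℕ}
    (hN : (digitLift α f).totalDegree ≤ N) : digitLift α f ∈ constructible
      (map (algebraMap k' k) '' weilDescentSystemWithFieldEqs α {f}) N := by
  have hq : 2 ≤ Nat.card k' := Finite.one_lt_card
  have hr := fun j => exists_reduced hq (coeffwise (α.coord j) (digitLift α f))
    ((totalDegree_coeffwise_le _ _).trans hN)
  choose r hr1 hr2 hr3 using hr
  have hlift : digitLift α f - ∑ j, map (algebraMap k' k) (r j) * C (α j) ∈
      Ideal.span (fieldEqs (Fin n) k (Nat.card k')) := by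
    nth_rewrite 1 [← sum_C_mul_map_coeffwise_coord α (digitLift α f)]
    rw [← Finset.sum_sub_distrib]
    refine sum_mem fun j _ => ?_
    rw [mul_comm, ← sub_mul, ← map_sub]
    exact Ideal.mul_mem_right _ _
      (map_mem_span_fieldEqs (constructible_le_span _ _ (hr3 j)))
  have hdesc : IsWeilDescent α f r := by
    refine ⟨fun i j => hr1 j i, ?_⟩
    have := sub_mem hlift (digitLift_sub_aeval_mem α f)
    rwa [sub_sub_sub_cancel_left, conjForm_zero] at this
  have hmem : ∀ j, map (algebraMap k' k) (r j) * C (α j) ∈ constructible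
      (map (algebraMap k' k) '' weilDescentSystemWithFieldEqs α {f}) N := fun j => by
    rw [mul_comm, ← smul_eq_C_mul]
    refine Submodule.smul_mem _ _ (mem_constructible_of_mem ⟨r j, ?_, rfl⟩ ?_)
    · rw [weilDescentSystemWithFieldEqs_singleton, hdesc.eq_weilDescent α]
      exact Or.inl ⟨j, rfl⟩
    · exact (totalDegree_map_le _ _).trans (hr2 j)
  have hsum := sum_mem fun j (_ : j ∈ Finset.univ) => hmem j
  have hdeg : (digitLift α f - ∑ j, map (algebraMap k' k) (r j) * C (α j)).totalDegree ≤ N := by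
    refine (totalDegree_sub _ _).trans (max_le hN (totalDegree_finsetSum_le fun j _ => ?_))
    refine (totalDegree_mul _ _).trans ?_
    rw [totalDegree_C, add_zero]
    exact (totalDegree_map_le _ _).trans (hr2 j)
  have := add_mem (constructible_mono (fieldEqs_subset_map_image α f)
    (mem_constructible_fieldEqs k' hlift hdeg)) hsum
  simpa using this

/-- The substitution `X_j ↦ ∑_{i < n} (δ_j T) ^ (q ^ i)` sends the ideal of the Weil descent system
into the ideal generated by `f` and `T ^ (q ^ n) - T`. -/
theorem aeval_tracePoly_mem_span (f : Polynomial k) {δ : Fin n → k}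
    (h1 : ∀ j l, ∑ i ∈ Finset.range n, δ j ^ Nat.card k' ^ i * α l ^ Nat.card k' ^ i =
      if j = l then 1 else 0)
    (h2 : ∀ i ∈ Finset.range n, ∑ j, α j * δ j ^ Nat.card k' ^ i = if i = 0 then 1 else 0)
    {g : MvPolynomial (Fin n) k'} (hg : g ∈ Ideal.span (weilDescentSystemWithFieldEqs α {f})) :
    aeval (fun j => tracePoly k' n (δ j)) (map (algebraMap k' k) g) ∈
      Ideal.span {f, Polynomial.X ^ Nat.card k' ^ n - Polynomial.X} := by
  have := Fintype.ofFinite k'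
  set I := Ideal.span {f, Polynomial.X ^ Nat.card k' ^ n - Polynomial.X}
  -- `Ψ` is the substitution followed by reduction modulo `I`.
  let Ψ : MvPolynomial (Fin n) k →ₐ[k] Polynomial k ⧸ I :=
    (Ideal.Quotient.mkₐ k I).comp (aeval fun j => tracePoly k' n (δ j))
  have hΨX : ∀ j, Ψ (X j) = Ideal.Quotient.mk I (tracePoly k' n (δ j)) := fun j => by simp [Ψ]
  have hfix : ∀ j, Ψ (X j) ^ Nat.card k' = Ψ (X j) := fun j => by
    rw [hΨX, ← map_pow, Ideal.Quotient.eq]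
    exact Ideal.span_mono (by simp) (tracePoly_pow_card_sub_mem α (δ j))
  have hfield : ∀ p ∈ Ideal.span (fieldEqs (Fin n) k (Nat.card k')), Ψ p = 0 := by
    intro p hp
    refine RingHom.mem_ker.1 ((?_ : Ideal.span _ ≤ RingHom.ker Ψ) hp)
    rw [Ideal.span_le]
    rintro _ ⟨j, rfl⟩
    simp only [SetLike.mem_coe, RingHom.mem_ker, map_sub, map_pow, hfix, sub_self]
  -- The images of polynomials over `k'` are fixed by the Frobenius map.
  have hfrob : ∀ p : MvPolynomial (Fin n) k',
      Ψ (map (algebraMap k' k) p) ^ Nat.card k' = Ψ (map (algebraMap k' k) p) := by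
    intro p
    let Ψ' : MvPolynomial (Fin n) k' →ₐ[k'] Polynomial k ⧸ I :=
      (Ψ.restrictScalars k').comp (mapAlgHom (Algebra.ofId k' k))
    have hcomp : (FiniteField.frobeniusAlgHom k' (Polynomial k ⧸ I)).comp Ψ' = Ψ' := by
      refine algHom_ext fun j => ?_
      have : Ψ' (X j) = Ψ (X j) := by simp [Ψ']
      rw [AlgHom.comp_apply, this, FiniteField.coe_frobeniusAlgHom]
      simpa [Nat.card_eq_fintype_card] using hfix j
    have := DFunLike.congr_fun hcomp p
    rw [AlgHom.comp_apply, FiniteField.coe_frobeniusAlgHom] at this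
    rw [Nat.card_eq_fintype_card]
    exact this
  let u : Fin n → Polynomial k ⧸ I := fun j => Ψ (map (algebraMap k' k) (weilDescent α f j))
  have hu0 : ∑ j, algebraMap k (Polynomial k ⧸ I) (α j) * u j = 0 := by
    have h := hfield _ (isWeilDescent_weilDescent α f).2
    rw [map_sub, sub_eq_zero, ← Polynomial.aeval_algHom_apply] at h
    have hT : Ψ (∑ j, C (α j) * X j) = Ideal.Quotient.mk I Polynomial.X := by
      rw [← sum_C_mul_tracePoly (α := α) h2, map_sum, map_sum]
      refine Finset.sum_congr rfl fun j _ => ?_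
      rw [map_mul, map_mul, hΨX, ← algebraMap_eq, AlgHom.commutes]
      rfl
    have hf : Polynomial.aeval (Ideal.Quotient.mk I Polynomial.X) f = 0 := by
      have := Polynomial.aeval_algHom_apply (Ideal.Quotient.mkₐ k I) Polynomial.X f
      rw [Polynomial.aeval_X_left_apply] at this
      refine this.trans (Ideal.Quotient.eq_zero_iff_mem.2 (Ideal.subset_span (by simp)))
    rw [hT, hf, map_sum] at h
    rw [h]
    refine Finset.sum_congr rfl fun j _ => ?_
    rw [map_mul, ← algebraMap_eq, AlgHom.commutes, mul_comm]
  -- The conjugates of the relation `∑ j, α_j u_j = 0`; inverting the matrix `(α_j ^ (q ^ i))`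
  -- yields the vanishing of every `u_j`.
  have hu : ∀ i : ℕ, ∑ j, algebraMap k (Polynomial k ⧸ I) (α j ^ Nat.card k' ^ i) * u j = 0 := by
    intro i
    induction i with
    | zero => simpa using hu0
    | succ i ih =>
      have := congrArg (· ^ Nat.card k') ih
      beta_reduce at this
      rw [sum_pow_card k', zero_pow Nat.card_pos.ne'] at this
      rw [← this]
      refine Finset.sum_congr rfl fun j _ => ?_
      rw [mul_pow, ← map_pow (algebraMap k _), ← pow_mul, ← pow_succ, hfrob]
  have hu' : ∀ j, u j = 0 := by
    intro j
    have h : ∑ i ∈ Finset.range n, algebraMap k (Polynomial k ⧸ I) (δ j ^ Nat.card k' ^ i) *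
        ∑ l, algebraMap k (Polynomial k ⧸ I) (α l ^ Nat.card k' ^ i) * u l = u j := by
      simp only [Finset.mul_sum]
      rw [Finset.sum_comm]
      simp only [← mul_assoc, ← map_mul, ← Finset.sum_mul, ← map_sum, h1]
      simp
    rw [← h]
    exact Finset.sum_eq_zero fun i _ => by rw [hu, mul_zero]
  have hker : Ideal.span (weilDescentSystemWithFieldEqs α {f}) ≤
      RingHom.ker ((Ψ : MvPolynomial (Fin n) k →+* Polynomial k ⧸ I).comp
        (map (algebraMap k' k))) := by
    rw [Ideal.span_le, weilDescentSystemWithFieldEqs_singleton]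
    rintro p (⟨j, rfl⟩ | hp)
    · exact hu' j
    · exact hfield _ (map_mem_span_fieldEqs (Ideal.subset_span hp))
  exact Ideal.Quotient.eq_zero_iff_mem.1 (RingHom.mem_ker.1 (hker hg))

/-- The bound holds for every `f` that has a representative of degree at most `(q - 1) (t + 1) + 1`. -/
theorem lastFallDegree_weilDescentSystem_le (f : Polynomial k) (t : ℕ)
    (hdeg : f.natDegree ≤ Nat.card k' ^ t)
    (hlift : (digitLift α f).totalDegree ≤ (Nat.card k' - 1) * (t + 1) + 1) :
    lastFallDegree (weilDescentSystemWithFieldEqs α {f}) ≤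
      (((Nat.card k' - 1) * (t + 1) + 1 : ℕ) : ℕ∞) := by
  refine lastFallDegree_le fun N hN g hg hgN => ?_
  rcases eq_or_ne f 0 with rfl | hf
  · -- The system consists of the field equations and zero.
    rw [weilDescentSystemWithFieldEqs_singleton] at hg ⊢
    refine constructible_mono Set.subset_union_right (mem_constructible_fieldEqs k' ?_ hgN)
    refine (Ideal.span_le.2 (Set.union_subset ?_ Ideal.subset_span) :
      Ideal.span _ ≤ Ideal.span (fieldEqs (Fin n) k' (Nat.card k'))) hg
    rintro _ ⟨j, rfl⟩
    rw [weilDescent_zero]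
    exact zero_mem _
  · obtain ⟨δ, h1, h2⟩ := exists_dual α
    refine mem_constructible_of_map_mem α (mem_constructible_of_aeval_mem
      (fieldEqs_subset_map_image α f) hf hdeg hN
      (digitLift_mem_constructible α f (hlift.trans hN)) h1 ((totalDegree_map_le _ _).trans hgN)
      (aeval_tracePoly_mem_span α f h1 h2 hg))

/-- The digit lift of a polynomial whose exponents have the form `q ^ θ + q ^ φ`, `q ^ ζ` or `0` is
at most quadratic. -/
theorem totalDegree_digitLift_quadratic_le {I J L : Type*} [Fintype I] [Fintype J] [Fintype L]
    (β : I → J → k) (θ φ : I → J → ℕ) (a : L → k) (ζ : L → ℕ) (μ : k) :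
    (digitLift α (∑ i, ∑ j, Polynomial.C (β i j) *
        Polynomial.X ^ (Nat.card k' ^ θ i j + Nat.card k' ^ φ i j) +
      ∑ l, Polynomial.C (a l) * Polynomial.X ^ Nat.card k' ^ ζ l +
        Polynomial.C μ)).totalDegree ≤ 2 := by
  simp only [map_add, map_sum, digitLift_C_mul_X_pow, digitLift_C, digitMonomial_pow]
  refine (totalDegree_add _ _).trans (max_le ((totalDegree_add _ _).trans (max_le ?_ ?_)) ?_)
  · exact totalDegree_finsetSum_le fun i _ => totalDegree_finsetSum_le fun j _ =>
      (totalDegree_smul_le _ _).trans (totalDegree_digitMonomial_pow_add_pow_le α _ _ 0)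
  · exact totalDegree_finsetSum_le fun l _ => (totalDegree_smul_le _ _).trans
      ((totalDegree_conjForm_le α _).trans one_le_two)
  · simp

end WeilDescentSystem

end HFE

theorem mainTheorem2 {k' k : Type*} [Field k'] [Finite k'] [Field k] [Algebra k' k]
    (q n : ℕ) (hq : Nat.card k' = q) (α : Module.Basis (Fin n) k' k)
    {I J L : Type*} [Fintype I] [Fintype J] [Fintype L]
    (β : I → J → k) (θ φ : I → J → ℕ) (a : L → k) (ζ : L → ℕ) (μ : k)
    (f : Polynomial k)
    (hf : f = ∑ i, ∑ j, Polynomial.C (β i j) * Polynomial.X ^ (q ^ θ i j + q ^ φ i j)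
      + ∑ l, Polynomial.C (a l) * Polynomial.X ^ q ^ ζ l + Polynomial.C μ)
    (t : ℕ) (hdeg : f.natDegree ≤ q ^ t) :
    HFE.lastFallDegree (HFE.weilDescentSystemWithFieldEqs α {f})
      ≤ (((q - 1) * (t + 1) + 1 : ℕ) : ℕ∞) := by
  subst hq
  refine HFE.lastFallDegree_weilDescentSystem_le α f t hdeg ?_
  have h2 : 1 < Nat.card k' := Finite.one_lt_card
  have h := HFE.totalDegree_digitLift_quadratic_le α β θ φ a ζ μ
  rw [← hf] at h
  rw [mul_add, mul_one]
  omega
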